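/- Let $n\ge 4$ be an even integer. The helm graph $H_n$ on $m=2n-1$ vertices is obtained from the wheel graph $W_n$ (a cycle on $n-1$ vertices together with a centre joined to all of them) by attaching a pendant edge to each vertex of the outer cycle. Its vertices are ordered as follows: the centre, then the $n-1$ vertices of the outer cycle in cyclic order, then the $n-1$ pendant vertices in the corresponding order. Let $I$ be the identity matrix of order $n-1$ and $\mathbf 1\in\mathbb R^{n-1}$ the column vector of ones. For $1\le k\le \frac n2-1$ define $c^k=(c^k_1,\dots,c^k_{n-1})'\in\mathbb R^{n-1}$ by $c^k_j=1$ if $j=k+1$ or $j=n-k$, and $c^k_j=0$ otherwise, and let $C_k$ be the $(n-1)\times(n-1)$ circulant matrix with first row $(c^k)'$, each further row being the cyclic shift of the previous row by one place to the right. The special Laplacian of $H_n$ is the real $m\times m$ matrix $$\mathcal L:=\frac12\begin{bmatrix} n-1 & -\mathbf 1' & 0\\ -\mathbf 1 & (n+1)I & -2I\\ 0 & -2I & 2I\end{bmatrix}+\sum_{k=1}^{\frac n2-1}(-1)^k\,\frac{(n-1)-2k}{2}\begin{bmatrix}0&0&0\\0&C_k&0\\0&0&0\end{bmatrix}.$$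 Theorem. The matrix $\mathcal L$ is positive semidefinite, that is, $\mathcal L$ is symmetric and $x'\mathcal L x\ge 0$ for all $x\in\mathbb R^m$. -/

import Mathlib

namespace Helm

/-- The vertex set of the helm graph `H_n` in three blocks: the centre of the wheel, the `n - 1`
vertices of the outer cycle (in cyclic order), and the `n - 1` pendant vertices (the `j`-th one
attached to the `j`-th vertex of the outer cycle). It has `2 n - 1` elements for `1 ≤ n`. -/
abbrev Vertex (n : ℕ) : Type := Unit ⊕ (Fin (n - 1) ⊕ Fin (n - 1))

/-- The `μ × μ` circulant matrix with first row `s`, each row being the cyclic shift of the previous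
one to the right by one place: the entry `(i, j)` is `s (j - i)`, indices modulo `μ`.
(Mathlib's `Matrix.circulant s` has `s` as its first column, whence the transpose.) -/
def Circ {μ : ℕ} (s : Fin μ → ℝ) : Matrix (Fin μ) (Fin μ) ℝ :=
  (Matrix.circulant s).transpose

/-- The vector `c^k` in `ℝ^(n-1)`: its `j`-th coordinate, `1 ≤ j ≤ n - 1`, is `1` if `j = k + 1` or
`j = n - k`, and `0` otherwise. The index `i : Fin (n - 1)` stands for `j = i + 1`. -/
def c (n k : ℕ) (i : Fin (n - 1)) : ℝ :=
  if (i : ℕ) + 1 = k + 1 ∨ (i : ℕ) + 1 = n - k then 1 else 0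

/-- A `3 × 3` block matrix on `Vertex n` whose central block is `P`, and whose other blocks are
a number `a`, row and column vectors `x`, `y`, `z`, `w`, and square matrices `Q`, `R`, `S`:
`[[a, x, y], [z, P, Q], [w, R, S]]`. -/
def blocks {n : ℕ} (a : ℝ) (x y z : Fin (n - 1) → ℝ) (P Q : Matrix (Fin (n - 1)) (Fin (n - 1)) ℝ)
    (w : Fin (n - 1) → ℝ) (R S : Matrix (Fin (n - 1)) (Fin (n - 1)) ℝ) :
    Matrix (Vertex n) (Vertex n) ℝ :=
  Matrix.fromBlocks
    (Matrix.of fun _ _ => a)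
    (Matrix.fromCols (Matrix.replicateRow Unit x) (Matrix.replicateRow Unit y))
    (Matrix.fromRows (Matrix.replicateCol Unit z) (Matrix.replicateCol Unit w))
    (Matrix.fromBlocks P Q R S)

/-- The special Laplacian matrix of the helm graph `H_n`. -/
noncomputable def specialLaplacian (n : ℕ) : Matrix (Vertex n) (Vertex n) ℝ :=
  (1 / 2 : ℝ) • blocks
      ((n : ℝ) - 1)   (-1)                                                      0
      (-1)            (((n : ℝ) + 1) • (1 : Matrix (Fin (n - 1)) (Fin (n - 1)) ℝ)) ((-2 : ℝ) • 1)
      0               ((-2 : ℝ) • 1)                                            ((2 : ℝ) • 1)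
    + ∑ k ∈ Finset.Icc 1 (n / 2 - 1), ((-1 : ℝ) ^ k * (((n : ℝ) - 1 - 2 * (k : ℝ)) / 2)) •
        blocks
          0 0            0
          0 (Circ (c n k)) 0
          0 0            0

end Helm

namespace Helm

open Finset

/-! Put N = n - 1, which is odd. Together with the diagonal N, the circulant sum forms the matrix K
with entries (-1)^(i+j) (N - 2|i - j|). This is a Gram matrix: K = ∑ v_t v_t' over t < N, where
v_t(i) = (-1)^i `threshold t i`. Moreover ∑ (-1)^t v_t is the all-ones vector, so Cauchy–Schwarz
gives (∑ y_i)² ≤ N y'Ky (`sq_sum_le_kernel_quadratic`). With a, y, p the centre, cycle and pendant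
parts of x, 2x'ℒx = N a² - 2a ∑ y_i + y'Ky + 2‖y - p‖²; the first three terms are nonnegative by
that bound. -/

/-- The `t`-th threshold sign vector: `1` from position `t` on, `-1` before. -/
def threshold (t i : ℕ) : ℝ := if t ≤ i then 1 else -1

/-- The gram matrix of the first `N` threshold vectors has entries `N - 2 |i - j|`. -/
theorem sum_threshold_mul_threshold {N i j : ℕ} (hij : i ≤ j) (hj : j < N) :
    ∑ t ∈ range N, threshold t i * threshold t j = (N : ℝ) - 2 * ((j : ℝ) - i) := by
  -- The two signs differ exactly when i < t ≤ j.
  have h : ∀ t ∈ range N, threshold t i * threshold t j =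
      1 - 2 * (if t ∈ Ioc i j then (1 : ℝ) else 0) := by
    intro t _
    simp only [threshold, mem_Ioc]
    split_ifs <;> first | omega | norm_num
  have hs : (range N).filter (fun t => t ∈ Ioc i j) = Ioc i j := by
    ext t
    simp only [mem_filter, mem_range, mem_Ioc]
    omega
  rw [sum_congr rfl h, sum_sub_distrib, ← mul_sum, ← sum_filter, hs]
  simp [Nat.cast_sub hij]

/-- The sum is twice the alternating sum over t ≤ i minus the full one, which is 1 for odd N. It
expresses the all-ones vector through the v_t. -/
theorem sum_neg_one_pow_mul_threshold {N i : ℕ} (hN : Odd N) (hi : i < N) :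
    ∑ t ∈ range N, (-1 : ℝ) ^ t * threshold t i = (-1) ^ i := by
  have h : ∀ t ∈ range N, (-1 : ℝ) ^ t * threshold t i =
      2 * (if t ∈ range (i + 1) then (-1 : ℝ) ^ t else 0) - (-1) ^ t := by
    intro t _
    simp only [threshold, mem_range, Nat.lt_succ_iff]
    split_ifs <;> ring
  have hs : (range N).filter (fun t => t ∈ range (i + 1)) = range (i + 1) := by
    ext t
    simp only [mem_filter, mem_range]
    omega
  rw [sum_congr rfl h, sum_sub_distrib, ← mul_sum, ← sum_filter, hs, neg_one_geom_sum,
    neg_one_geom_sum, if_neg (Nat.not_even_iff_odd.2 hN)]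
  rcases Nat.even_or_odd i with hi | hi
  · rw [hi.neg_one_pow, if_neg (Nat.not_even_iff_odd.2 hi.add_one)]
    norm_num
  · rw [hi.neg_one_pow, if_pos hi.add_one]
    norm_num

/-- The signed distance kernel `(-1) ^ (i + j) (N - 2 |i - j|)`. -/
def kernel (N i j : ℕ) : ℝ := ∑ t ∈ range N, (-1 : ℝ) ^ (i + j) * (threshold t i * threshold t j)

theorem kernel_comm (N i j : ℕ) : kernel N i j = kernel N j i := by
  simp only [kernel, add_comm i j, mul_comm (threshold _ i)]

theorem kernel_of_le {N i j : ℕ} (hij : i ≤ j) (hj : j < N) :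
    kernel N i j = (-1) ^ (j - i) * ((N : ℝ) - 2 * ((j - i : ℕ) : ℝ)) := by
  rw [kernel, ← mul_sum, sum_threshold_mul_threshold hij hj, Nat.cast_sub hij]
  congr 1
  obtain ⟨d, rfl⟩ := Nat.exists_eq_add_of_le hij
  rw [Nat.add_sub_cancel_left, ← add_assoc, pow_add, (Even.add_self i).neg_one_pow, one_mul]

theorem kernel_quadratic {N : ℕ} (y : Fin N → ℝ) :
    ∑ i : Fin N, ∑ j : Fin N, y i * (kernel N i j * y j) =
      ∑ t ∈ range N, (∑ i : Fin N, (-1 : ℝ) ^ (i : ℕ) * threshold t i * y i) ^ 2 := by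
  have h : ∀ t, (∑ i : Fin N, (-1 : ℝ) ^ (i : ℕ) * threshold t i * y i) ^ 2 =
      ∑ i : Fin N, ∑ j : Fin N,
        y i * ((-1) ^ ((i : ℕ) + j) * (threshold t i * threshold t j) * y j) := by
    intro t
    rw [sq, sum_mul_sum]
    refine sum_congr rfl fun i _ => sum_congr rfl fun j _ => ?_
    ring
  simp only [h, kernel, sum_mul, mul_sum]
  rw [sum_comm (s := range N)]
  exact sum_congr rfl fun i _ => sum_comm

theorem sq_sum_le_kernel_quadratic {N : ℕ} (hN : Odd N) (y : Fin N → ℝ) :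
    (∑ i, y i) ^ 2 ≤ N * ∑ i : Fin N, ∑ j : Fin N, y i * (kernel N i j * y j) := by
  have h : ∑ i, y i = ∑ t ∈ range N,
      (-1 : ℝ) ^ t * ∑ i : Fin N, (-1 : ℝ) ^ (i : ℕ) * threshold t i * y i := by
    simp only [mul_sum]
    rw [sum_comm]
    refine sum_congr rfl fun i _ => ?_
    have := sum_neg_one_pow_mul_threshold hN i.2
    calc y i = (-1) ^ (i : ℕ) * (-1) ^ (i : ℕ) * y i := by
          rw [← pow_add, (Even.add_self _).neg_one_pow, one_mul]
      _ = _ := by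
          nth_rw 2 [← this]
          rw [mul_sum, sum_mul]
          refine sum_congr rfl fun t _ => by ring
  rw [kernel_quadratic, h]
  refine (sum_mul_sq_le_sq_mul_sq _ _ _).trans (le_of_eq ?_)
  simp [← pow_mul, mul_comm _ 2]

theorem Circ_apply {μ : ℕ} (s : Fin μ → ℝ) (i j : Fin μ) : Circ s i j = s (j - i) := rfl

/-- Here d + e is odd, so the signs are opposite, and so are the factors e - d and d - e. Hence the
weight depends only on cyclic distance, which makes K circulant. -/
theorem signed_distance_reflect {n d e : ℕ} (heven : Even n) (h : n = d + 1 + e) :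
    (-1 : ℝ) ^ e * ((n : ℝ) - 1 - 2 * e) = (-1) ^ d * ((n : ℝ) - 1 - 2 * d) := by
  subst h
  have h1 := heven.neg_one_pow (α := ℝ)
  rw [pow_add, pow_succ] at h1
  have hp : (-1 : ℝ) ^ d = -(-1) ^ e := by
    rcases neg_one_pow_eq_or ℝ e with h3 | h3 <;> rw [h3] at h1 ⊢ <;> linarith
  rw [hp]
  push_cast
  ring

/-- The alternating circulant sum at cyclic distance `d`. -/
theorem sum_mul_c {n : ℕ} (hn : 4 ≤ n) (heven : Even n) (d : Fin (n - 1)) :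
    ∑ k ∈ Icc 1 (n / 2 - 1), (-1 : ℝ) ^ k * ((n : ℝ) - 1 - 2 * k) * c n k d =
      if (d : ℕ) = 0 then 0 else (-1) ^ (d : ℕ) * ((n : ℝ) - 1 - 2 * (d : ℕ)) := by
  obtain ⟨m, rfl⟩ := heven
  have hd := d.2
  -- In 0-based indexing `c n k` is supported at k < m and n - 1 - k ≥ m, so at most one k
  -- contributes.
  rcases Nat.lt_or_ge (d : ℕ) m with h | h
  · split_ifs with h0
    · refine sum_eq_zero fun k hk => ?_
      rw [mem_Icc] at hk
      rw [c, if_neg (by omega), mul_zero]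
    · rw [sum_eq_single (d : ℕ)]
      · simp [c]
      · intro k hk hkd
        rw [mem_Icc] at hk
        rw [c, if_neg (by omega), mul_zero]
      · intro hk
        rw [mem_Icc] at hk
        omega
  · rw [if_neg (by omega), sum_eq_single (m + m - 1 - d)]
    · rw [c, if_pos (by omega), mul_one]
      obtain ⟨e, he⟩ : ∃ e, m + m = d + 1 + e := Nat.exists_eq_add_of_le (by omega)
      have hs : m + m - 1 - d = e := by omega
      rw [hs, signed_distance_reflect ⟨m, rfl⟩ he]
    · intro k hk hkd
      rw [mem_Icc] at hk
      rw [c, if_neg (by omega), mul_zero]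
    · intro hk
      rw [mem_Icc] at hk
      omega

theorem diagonal_add_sum_Circ {n : ℕ} (hn : 4 ≤ n) (heven : Even n) (i j : Fin (n - 1)) :
    (if i = j then (n : ℝ) - 1 else 0) +
      ∑ k ∈ Icc 1 (n / 2 - 1), (-1 : ℝ) ^ k * ((n : ℝ) - 1 - 2 * k) * Circ (c n k) i j =
    kernel (n - 1) i j := by
  simp only [Circ_apply]
  rw [sum_mul_c hn heven]
  have hcast : ((n - 1 : ℕ) : ℝ) = (n : ℝ) - 1 := by
    rw [Nat.cast_sub (by omega), Nat.cast_one]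
  rcases le_or_gt i j with hij | hij
  · have hval : ((j - i : Fin (n - 1)) : ℕ) = j - i := Fin.sub_val_of_le hij
    rw [kernel_of_le hij j.2, hval, hcast]
    rcases eq_or_lt_of_le hij with rfl | h
    · simp
    · rw [if_neg h.ne, if_neg (by have := Fin.lt_def.1 h; omega), zero_add]
  -- Below the diagonal j - i wraps around to n - 1 - (i - j), which reflection turns back into i -
  -- j.
  · have hlt := Fin.lt_def.1 hij
    have hval : ((j - i : Fin (n - 1)) : ℕ) = n - 1 + j - i := Fin.coe_sub_iff_lt.2 hij
    rw [kernel_comm, kernel_of_le hij.le i.2, hval, hcast, if_neg hij.ne', if_neg (by omega),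
      zero_add]
    obtain ⟨d, hd⟩ := Nat.exists_eq_add_of_le hlt.le
    obtain ⟨e, he⟩ : ∃ e, n = d + 1 + e := Nat.exists_eq_add_of_le (by omega)
    have h1 : n - 1 + (j : ℕ) - i = e := by omega
    have h2 : (i : ℕ) - j = d := by omega
    rw [h1, h2, signed_distance_reflect heven he]

/-- The special Laplacian with the circulant sum in closed form. -/
theorem specialLaplacian_eq {n : ℕ} (hn : 4 ≤ n) (heven : Even n) :
    specialLaplacian n = (1 / 2 : ℝ) • blocks ((n : ℝ) - 1) (-1) 0 (-1)
      (Matrix.of (fun i j : Fin (n - 1) => kernel (n - 1) i j) + (2 : ℝ) • 1)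
      ((-2 : ℝ) • 1) 0 ((-2 : ℝ) • 1) ((2 : ℝ) • 1) := by
  ext (u | i | i) (v | j | j)
  case inr.inl.inr.inl =>
    simp only [specialLaplacian, blocks, Matrix.add_apply, Matrix.smul_apply, Matrix.sum_apply,
      Matrix.fromBlocks_apply₂₂, Matrix.fromBlocks_apply₁₁, Matrix.of_apply, smul_eq_mul,
      Matrix.one_apply, ← diagonal_add_sum_Circ hn heven, mul_add, mul_sum]
    rw [add_right_comm]
    congr 1
    · split_ifs <;> ring
    · exact sum_congr rfl fun k _ => by ring
  all_goals simp [specialLaplacian, blocks, Matrix.sum_apply]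

theorem isHermitian_specialLaplacian {n : ℕ} (hn : 4 ≤ n) (heven : Even n) :
    (specialLaplacian n).IsHermitian := by
  rw [specialLaplacian_eq hn heven]
  ext (u | i | i) (v | j | j) <;>
    simp [blocks, Matrix.one_apply, eq_comm, kernel_comm]

theorem quadratic_specialLaplacian {n : ℕ} (hn : 4 ≤ n) (heven : Even n) (x : Vertex n → ℝ) :
    x ⬝ᵥ Matrix.mulVec (specialLaplacian n) x =
      1 / 2 * (((n : ℝ) - 1) * x (.inl ()) ^ 2 - 2 * x (.inl ()) * ∑ i, x (.inr (.inl i)) +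
        ∑ i : Fin (n - 1), ∑ j : Fin (n - 1), x (.inr (.inl i)) * (kernel (n - 1) i j * x (.inr (.inl j))) +
        2 * ∑ i, (x (.inr (.inl i)) - x (.inr (.inr i))) ^ 2) := by
  have h : ∑ i, (x (.inr (.inl i)) - x (.inr (.inr i))) ^ 2 =
      ∑ i, x (.inr (.inl i)) * x (.inr (.inl i)) - 2 * ∑ i, x (.inr (.inl i)) * x (.inr (.inr i)) +
        ∑ i, x (.inr (.inr i)) * x (.inr (.inr i)) := by
    rw [mul_sum, ← sum_sub_distrib, ← sum_add_distrib]
    exact sum_congr rfl fun i _ => by ring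
  rw [specialLaplacian_eq hn heven, h]
  simp only [dotProduct, Matrix.mulVec, Fintype.sum_sum_type, blocks, Matrix.smul_apply]
  simp [Matrix.one_apply, mul_add, add_mul, sum_add_distrib, mul_assoc, ← mul_sum]
  have hc : ∑ i, x (.inr (.inr i)) * x (.inr (.inl i)) =
      ∑ i, x (.inr (.inl i)) * x (.inr (.inr i)) := sum_congr rfl fun i _ => mul_comm _ _
  have hl (f : Fin (n - 1) → ℝ) : ∑ i, x (.inr (.inl i)) * (2⁻¹ * f i) =
      2⁻¹ * ∑ i, x (.inr (.inl i)) * f i := by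
    rw [mul_sum]
    exact sum_congr rfl fun i _ => mul_left_comm _ _ _
  rw [hc, hl fun i => ∑ j : Fin (n - 1), kernel (n - 1) i j * x (.inr (.inl j)),
    hl fun _ => x (.inl ()), ← sum_mul]
  ring

end Helm

theorem mainTheorem4 (n : ℕ) (hn : 4 ≤ n) (heven : Even n) :
    (Helm.specialLaplacian n).PosSemidef := by
  refine .of_dotProduct_mulVec_nonneg (Helm.isHermitian_specialLaplacian hn heven) fun x => ?_
  rw [star_trivial, Helm.quadratic_specialLaplacian hn heven]
  have hodd : Odd (n - 1) := Nat.Even.sub_odd (by omega) heven odd_one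
  have hS := Helm.sq_sum_le_kernel_quadratic hodd fun i => x (.inr (.inl i))
  have hcast : ((n - 1 : ℕ) : ℝ) = (n : ℝ) - 1 := by
    rw [Nat.cast_sub (by omega), Nat.cast_one]
  rw [hcast] at hS
  have hpos : 0 < (n : ℝ) - 1 := by
    have : (4 : ℝ) ≤ n := by exact_mod_cast hn
    linarith
  have hz : 0 ≤ ∑ i, (x (.inr (.inl i)) - x (.inr (.inr i))) ^ 2 :=
    Finset.sum_nonneg fun i _ => sq_nonneg _
  generalize ∑ i, (x (.inr (.inl i)) - x (.inr (.inr i))) ^ 2 = z at hz ⊢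
  generalize ∑ i : Fin (n - 1), ∑ j : Fin (n - 1), x (.inr (.inl i)) * (Helm.kernel (n - 1) i j * x (.inr (.inl j))) = q
    at hS ⊢
  generalize ∑ i, x (.inr (.inl i)) = s at hS ⊢
  generalize x (.inl ()) = a
  -- Multiplied by N = n - 1, the right side is (N a - s)² + (N q - s²).
  have key : 0 ≤ ((n : ℝ) - 1) * a ^ 2 - 2 * a * s + q := by
    refine nonneg_of_mul_nonneg_right ?_ hpos
    nlinarith [sq_nonneg (((n : ℝ) - 1) * a - s)]
  linarith
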